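/- Let $E=\mathbb R$ (continuous case) or $E=\mathbb Z$ (discrete case). For $a\in\mathbb R$ let $\lfloor a\rceil!=\Gamma(a+1)$ if $a$ is not a negative integer, and $\lfloor -(k+1)\rceil!=(-1)^k/k!$ for $k\in\mathbb N$; let $\lfloor a\rceil=a$ for $a\ne0$ and $\lfloor 0\rceil=1$. **Operators and series.** Let $\Lambda^+$ be the algebra of Artinian operators, the formal series $\sum_{b\in E}c_bD^b$ with complex coefficients and well-ordered support (for $E=\mathbb Z$: the Laurent series in $D$), and, for $E=\mathbb Z$, let $\Lambda\subset\Lambda^+$ be the algebra of differential operators, the formal power series in $D$. For an integer vector $\alpha$ of finite support, let $\mathcal I^\alpha$ be the space of series $\sum_{a\in E}c_a\lambda_a^\alpha(x)$ in the harmonic logarithms of order $\alpha$ with Noetherian (reverse well-ordered) support, where $\lambda^{(0)}_a=0$ if $a$ is a negative integer and the other $\lambda_a^\alpha$ are independent; let $\mathcal I=\bigoplus_\alpha\mathcal I^\alpha$. Operators act by $$D^b\lambda_a^\alpha(x)=\frac{\lfloor a\rceil!}{\lfloor a-b\rceil!}\lambda_{a-b}^\alpha(x),$$ where $\Lambda^+$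 acts on $\mathcal I^\alpha$ for $\alpha\ne(0)$ and $\Lambda$ acts on $\mathcal I^{(0)}$. Let $\langle p(x)\rangle_\alpha$ be the coefficient of $\lambda_0^\alpha(x)$ in $p(x)$. A linear operator is called continuous if it commutes with convergent infinite sums (families with Noetherian union of supports, only finitely many members of which contribute to any given coefficient). **Roman graded sequences.** A delta operator is an operator $f(D)\in\Lambda^+$ whose lowest term has degree $1$. If $f(D)=cD(1+h)$ with $h$ of positive degree, $a\in\mathbb R$ and $n\in\mathbb Z$, put $$f(D)^{a;n}=e^{a(\log c+2\pi in)}D^a\sum_{k\ge0}\binom ak h^k,$$ with $\log$ the principal branch. A Roman graded sequence is a regular graded sequence that is associated (in the continuous case: $n$-th associated for some $n\in\mathbb Z$) with some delta operator $f(D)$. That is: $p_a^\alpha(x)\in\mathcal I^\alpha$ has degree $a$ (and $p_a^{(0)}=0$ if $a$ is a negative integer); the coefficient of $\lambda_b^\alpha$ in $p_a^\alpha$ is the same for all $\alpha\neq(0)$, and also for $\alpha=(0)$ if neither $a$ nor $b$ is a negative integer; and, for all $\alpha\ne(0)$, $\langle p_0^\alpha\rangle_\alpha=1$, $\langle p_a^\alpha\rangle_\alpha=0$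 for $a\neq0$, and - (discrete case) $f(D)p_a^\alpha(x)=\lfloor a\rceil\,p_{a-1}^\alpha(x)$ for all $a\in\mathbb Z$; - (continuous case) $f(D)^{b;n}p_a^\alpha(x)=\dfrac{\lfloor a\rceil!}{\lfloor a-b\rceil!}\,p_{a-b}^\alpha(x)$ for all $a,b\in\mathbb R$. A transfer operator is a continuous linear operator $\tau:\mathcal I\to\mathcal I$ with $\tau\lambda_a^\alpha(x)=p_a^\alpha(x)$ for all $a$ and $\alpha$, for some Roman graded sequence $(p_a^\alpha)$. **Proposition.** Let $\tau$ be a transfer operator. In both cases there is exactly one linear operator $\tau^*:\Lambda^+\to\Lambda^+$ (the adjoint of $\tau$) such that $$\langle[\tau^*f(D)]\,p(x)\rangle_\alpha=\langle f(D)\,\tau p(x)\rangle_\alpha\qquad\text{for all }\alpha\neq(0),\ p(x)\in\mathcal I^\alpha,\ f(D)\in\Lambda^+,$$ and $\tau^*$ is an automorphism of the $\mathbb C$-algebra $\Lambda^+$. In the discrete case there is moreover exactly one linear operator $\tau^{*(0)}:\Lambda\to\Lambda$ such that $$\langle[\tau^{*(0)}f(D)]\,p(x)\rangle_{(0)}=\langle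 f(D)\,\tau p(x)\rangle_{(0)}\qquad\text{for all }p(x)\in\mathcal I^{(0)},\ f(D)\in\Lambda,$$ and $\tau^{*(0)}$ is an automorphism of the $\mathbb C$-algebra $\Lambda$. -/

import Mathlib

open scoped DirectSum Classical

noncomputable section

/-! ## Roman numbers and factorials -/

/-- `e` is a negative integer. -/
def IsNegInt {E : Type} [Ring E] (e : E) : Prop := ∃ k : ℕ, e = -((k : E) + 1)

/-- The Roman number: `⌊a⌉ = a` for `a ≠ 0`, and `⌊0⌉ = 1`. -/
def romanNumber (a : ℝ) : ℝ := if a = 0 then 1 else a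

/-- The Roman factorial: `⌊a⌉! = Γ(a + 1)` unless `a` is a negative integer, and
`⌊-(k+1)⌉! = (-1)^k / k!` for natural numbers `k`; thus `⌊a⌉! = ⌊a⌉ ⌊a - 1⌉!` for all `a`. -/
def romanFactorial (a : ℝ) : ℝ :=
  if h : IsNegInt a then (-1) ^ h.choose / (h.choose.factorial : ℝ) else Real.Gamma (a + 1)

section General

/-! The exponents lie in `E`, which is `ℤ` in the discrete case and `ℝ` in the continuous case. -/

variable (E : Type) [CommRing E] [LinearOrder E] [IsStrictOrderedRing E] [Algebra E ℝ]

/-! ## Operators and logarithmic series -/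

/-- The algebra `Λ⁺` of Artinian operators: formal series `∑ c_b D^b` whose support is well ordered
(Artinian). For `E = ℤ` these are the Laurent series in `D`. -/
abbrev ArtinianOp : Type := HahnSeries E ℂ

/-- The usual `ℂ`-algebra structure of Hahn series, preferred to the propositionally equal one that
Mathlib defines through power series. -/
instance artinianOpAlgebra : Algebra ℂ (HahnSeries E ℂ) := HahnSeries.instAlgebra

/-- The index `α` of the harmonic logarithms: an integer vector with finite support. -/
abbrev LogIndex : Type := ℕ →₀ ℤ

/-- Formal series `∑ c_a λ_a` with Noetherian support (every nonempty subset of the support has a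
largest element). -/
abbrev NoetherianSeries : Type := HahnSeries Eᵒᵈ ℂ

/-- The component `I^α`: all series `∑ c_a λ_a^α(x)` with Noetherian support in the harmonic
logarithms of order `α`. Since `λ_a^{(0)} = 0` for negative integers `a`, these indices do not occur
for `α = (0)`. -/
def LogComp (α : LogIndex) : Submodule ℂ (NoetherianSeries E) where
  carrier := {q | α = 0 → ∀ e : E, IsNegInt e → q.coeff (OrderDual.toDual e) = 0}
  add_mem' := by
    intro p q hp hq hα e he
    rw [HahnSeries.coeff_add, hp hα e he, hq hα e he, add_zero]
  zero_mem' := by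
    intro _ e _
    rfl
  smul_mem' := by
    intro c q hq hα e he
    rw [HahnSeries.coeff_smul, hq hα e he, smul_zero]

/-- The logarithmic algebra `I`, the direct sum of the `I^α`, as a vector space. -/
abbrev LogSeries : Type := ⨁ α : LogIndex, LogComp E α

variable {E}

/-- `[λ_e^α(x)] q(x)`, the coefficient of a harmonic logarithm. -/
def logCoeff {α : LogIndex} (q : LogComp E α) (e : E) : ℂ :=
  (q : NoetherianSeries E).coeff (OrderDual.toDual e)

/-- The augmentation `⟨q(x)⟩_α`, the coefficient of `λ_0^α(x)`. -/
def augmentation {α : LogIndex} (q : LogComp E α) : ℂ := logCoeff q 0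

/-- The harmonic logarithm `λ_a^α(x)`; it is `0` if `α = (0)` and `a` is a negative integer. -/
def harmonicLog (α : LogIndex) (a : E) : LogComp E α :=
  if h : α = 0 ∧ IsNegInt a then 0
  else ⟨HahnSeries.single (OrderDual.toDual a) 1, by
    intro hα e he
    refine HahnSeries.coeff_single_of_ne ?_
    intro hea
    exact h ⟨hα, (OrderDual.toDual.injective hea) ▸ he⟩⟩

/-- The inclusion of `I^α` in `I`. -/
def ofComp (α : LogIndex) : LogComp E α →ₗ[ℂ] LogSeries E :=
  DirectSum.lof ℂ LogIndex (fun α => LogComp E α) α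

/-- `⌊a⌉! / ⌊e⌉!` -/
def romanRatio (a e : E) : ℂ :=
  ((romanFactorial (algebraMap E ℝ a) / romanFactorial (algebraMap E ℝ e) : ℝ) : ℂ)

/-- The coefficient of `λ_e` in `f(D) q(x)`, according to
`D^b λ_a^α(x) = (⌊a⌉! / ⌊a-b⌉!) λ_{a-b}^α(x)`. The sum is finite. -/
def actCoeff (f : ArtinianOp E) (q : NoetherianSeries E) (e : E) : ℂ :=
  ∑ᶠ b : E, f.coeff b * q.coeff (OrderDual.toDual (e + b)) * romanRatio (e + b) e

/-- The sum in `actCoeff` has only finitely many nonzero terms. -/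
theorem actCoeff_finite (f : ArtinianOp E) (q : NoetherianSeries E) (e : E) :
    {b : E | f.coeff b * q.coeff (OrderDual.toDual (e + b)) * romanRatio (e + b) e ≠ 0}.Finite := by
  by_contra hinf
  have hS : Set.Infinite {b : E | f.coeff b * q.coeff (OrderDual.toDual (e + b)) *
      romanRatio (e + b) e ≠ 0} := hinf
  have hf : ∀ n, (hS.natEmbedding _ n : E) ∈ f.support := fun n h0 =>
    (hS.natEmbedding _ n).2 (by rw [h0, zero_mul, zero_mul])
  have hq : ∀ n, OrderDual.toDual (e + (hS.natEmbedding _ n : E)) ∈ q.support := fun n h0 =>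
    (hS.natEmbedding _ n).2 (by rw [h0, mul_zero, zero_mul])
  obtain ⟨g, hg⟩ := (Set.isPWO_iff_exists_monotone_subseq.1 f.isPWO_support) _ hf
  obtain ⟨m, n, hmn, hle⟩ := q.isPWO_support
    (fun n => ⟨OrderDual.toDual (e + (hS.natEmbedding _ (g n) : E)), hq (g n)⟩)
  have h1 : (hS.natEmbedding _ (g m) : E) ≤ hS.natEmbedding _ (g n) := hg hmn.le
  have h2 : e + (hS.natEmbedding _ (g n) : E) ≤ e + hS.natEmbedding _ (g m) := hle
  have h3 := le_antisymm h1 (by simpa using h2)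
  exact hmn.ne (g.injective ((hS.natEmbedding _).injective (Subtype.ext h3)))

theorem actCoeff_support (f : ArtinianOp E) (q : NoetherianSeries E) :
    (Function.support fun e : Eᵒᵈ => actCoeff f q (OrderDual.ofDual e)).IsPWO := by
  have hneg : ((fun b : E => (OrderDual.toDual (-b) : Eᵒᵈ)) '' f.support).IsPWO := by
    refine f.isPWO_support.image_of_monotone ?_
    intro b c hbc
    exact OrderDual.toDual_le_toDual.2 (neg_le_neg hbc)
  refine (q.isPWO_support.add hneg).mono ?_
  intro e he
  obtain ⟨b, hb⟩ : ∃ b : E, f.coeff b * q.coeff (OrderDual.toDual (OrderDual.ofDual e + b)) *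
      romanRatio (OrderDual.ofDual e + b) (OrderDual.ofDual e) ≠ 0 := by
    by_contra! h0
    exact he (finsum_eq_zero_of_forall_eq_zero h0)
  refine ⟨OrderDual.toDual (OrderDual.ofDual e + b), ?_, OrderDual.toDual (-b), ⟨b, ?_, rfl⟩, ?_⟩
  · intro h0
    exact hb (by rw [h0, mul_zero, zero_mul])
  · intro h0
    exact hb (by rw [h0, zero_mul, zero_mul])
  · exact congrArg OrderDual.toDual (add_neg_cancel_right (OrderDual.ofDual e) b)

/-- The action of an operator on `I^α`. Terms `λ_e^{(0)}` with `e` a negative integer vanish.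
All of `Λ⁺` acts on `I^α` for `α ≠ (0)`; on `I^{(0)}` only differential operators will be used. -/
def act (α : LogIndex) (f : ArtinianOp E) (q : LogComp E α) : LogComp E α :=
  ⟨{ coeff := fun e => if α = 0 ∧ IsNegInt (OrderDual.ofDual e) then 0
        else actCoeff f q (OrderDual.ofDual e)
     isPWO_support' := (actCoeff_support f q).mono (by
        intro e he h0
        refine he ?_
        have h0' : actCoeff f q (OrderDual.ofDual e) = 0 := h0
        simp only [h0', ite_self]) },
    by
      intro hα e he
      exact if_pos ⟨hα, he⟩⟩

/-! ## Continuous operators and adjoints -/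

/-- A linear operator on `I` is continuous if it commutes with convergent infinite sums: whenever a
family in `I^α` is summable, so is each `I^β`-component of its image, and the sum is mapped to the
sum. -/
def IsContinuousOp (θ : LogSeries E →ₗ[ℂ] LogSeries E) : Prop :=
  ∀ (α β : LogIndex) (ι : Type) (s : HahnSeries.SummableFamily Eᵒᵈ ℂ ι)
    (hs : ∀ i, s i ∈ LogComp E α) (hsum : s.hsum ∈ LogComp E α),
    ∃ t : HahnSeries.SummableFamily Eᵒᵈ ℂ ι,
      (∀ i, t i = (θ (ofComp α ⟨s i, hs i⟩) β : NoetherianSeries E)) ∧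
      (θ (ofComp α ⟨s.hsum, hsum⟩) β : NoetherianSeries E) = t.hsum

/-- `A` satisfies the defining equation of the adjoint of `θ` on `Λ⁺`:
`⟨(A f(D)) q(x)⟩_α = ⟨f(D) θ q(x)⟩_α` for all `α ≠ (0)`, `f(D) ∈ Λ⁺` and `q(x) ∈ I^α`. -/
def IsAdjoint (θ : LogSeries E →ₗ[ℂ] LogSeries E) (A : ArtinianOp E →ₗ[ℂ] ArtinianOp E) : Prop :=
  ∀ α : LogIndex, α ≠ 0 → ∀ (f : ArtinianOp E) (q : LogComp E α),
    augmentation (act α (A f) q) = augmentation (act α f (θ (ofComp α q) α))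

/-- The algebra `Λ` of differential operators: the formal power series in `D`. -/
def DiffOp : Subalgebra ℂ (ArtinianOp ℤ) := (HahnSeries.ofPowerSeriesAlg ℤ ℂ).range

/-- `A` satisfies the defining equation of the adjoint of the restriction of `θ` to `I^{(0)}`:
`⟨(A f(D)) q(x)⟩_{(0)} = ⟨f(D) θ q(x)⟩_{(0)}` for all `f(D) ∈ Λ` and `q(x) ∈ I^{(0)}`. -/
def IsAdjointZero (θ : LogSeries ℤ →ₗ[ℂ] LogSeries ℤ) (A : DiffOp →ₗ[ℂ] DiffOp) : Prop :=
  ∀ (f : DiffOp) (q : LogComp ℤ 0),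
    augmentation (act 0 (A f : ArtinianOp ℤ) q) =
      augmentation (act 0 (f : ArtinianOp ℤ) (θ (ofComp 0 q) 0))

/-! ## Roman graded sequences and transfer operators -/

/-- A regular graded sequence `p_a^α(x) ∈ I^α`: `p_a^α(x)` has degree `a` (unless `λ_a^α(x) = 0`, in
which case `p_a^α(x) = 0`), the coefficients do not depend on `α ≠ (0)`, and those of `p_a^{(0)}(x)`
are the same wherever `λ_a^{(0)}` and `λ_b^{(0)}` are not zero. -/
structure IsRegularGraded (p : ∀ α : LogIndex, E → LogComp E α) : Prop where
  lead : ∀ α a, ¬ (α = 0 ∧ IsNegInt a) → logCoeff (p α a) a ≠ 0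
  degree : ∀ α (a b : E), a < b → logCoeff (p α a) b = 0
  zero : ∀ a : E, IsNegInt a → p 0 a = 0
  regular : ∀ α β, α ≠ 0 → β ≠ 0 → ∀ a b : E, logCoeff (p α a) b = logCoeff (p β a) b
  regular_zero : ∀ α, α ≠ 0 → ∀ a b : E, ¬ IsNegInt a → ¬ IsNegInt b →
    logCoeff (p 0 a) b = logCoeff (p α a) b

/-- `⟨p_0^α(x)⟩_α = 1`, and `⟨p_a^α(x)⟩_α = 0` for `a ≠ 0` (for `α ≠ (0)`; in a regular
graded sequence the case `α = (0)` follows). -/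
def IsNormalized (p : ∀ α : LogIndex, E → LogComp E α) : Prop :=
  ∀ α, α ≠ 0 → ∀ a : E, augmentation (p α a) = if a = 0 then 1 else 0

/-- A delta operator: an operator of degree one. -/
def IsDelta (f : ArtinianOp E) : Prop := f.orderTop = ((1 : E) : WithTop E)

/-- The transfer operator of `p`: the continuous linear operator on `I` with
`τ λ_a^α(x) = p_a^α(x)` for all `a` and `α`. -/
def IsTransferOf (p : ∀ α : LogIndex, E → LogComp E α) (τ : LogSeries E →ₗ[ℂ] LogSeries E) :
    Prop :=
  IsContinuousOp τ ∧ ∀ α a, τ (ofComp α (harmonicLog α a)) = ofComp α (p α a)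

end General

/-- The power `f(D)^{a;n}` of a delta operator with a real exponent: if `f = c D (1 + h)` with `h` of
positive degree, then `f^{a;n} = e^{a (log c + 2πin)} D^a ∑_k binom(a,k) h^k`. -/
def deltaPow (f : ArtinianOp ℝ) (n : ℤ) (a : ℝ) : ArtinianOp ℝ :=
  HahnSeries.single a
      (Complex.exp ((a : ℂ) * (Complex.log f.leadingCoeff + 2 * Real.pi * Complex.I * (n : ℂ)))) *
    PowerSeries.heval (HahnSeries.single (-1) f.leadingCoeff⁻¹ * f - 1)
      (PowerSeries.binomialSeries ℂ a)

/-- Discrete case: the sequence `p` is the associated graded sequence of the delta operator `f(D)`,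
that is, it is normalized and `f(D) p_a^α(x) = ⌊a⌉ p_{a-1}^α(x)`. -/
def IsAssociatedDiscrete (f : ArtinianOp ℤ) (p : ∀ α : LogIndex, ℤ → LogComp ℤ α) : Prop :=
  IsDelta f ∧ IsRegularGraded p ∧ IsNormalized p ∧
  ∀ α, α ≠ 0 → ∀ a : ℤ, act α f (p α a) = ((romanNumber a : ℝ) : ℂ) • p α (a - 1)

/-- Continuous case: the sequence `p` is the `n`-th associated graded sequence of the delta operator
`f(D)`, that is, it is normalized and `f(D)^{b;n} p_a^α(x) = (⌊a⌉! / ⌊a-b⌉!) p_{a-b}^α(x)`. -/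
def IsAssociatedContinuous (f : ArtinianOp ℝ) (n : ℤ) (p : ∀ α : LogIndex, ℝ → LogComp ℝ α) :
    Prop :=
  IsDelta f ∧ IsRegularGraded p ∧ IsNormalized p ∧
  ∀ α, α ≠ 0 → ∀ a b : ℝ, act α (deltaPow f n b) (p α a) = romanRatio a (a - b) • p α (a - b)

/-- Discrete case: `τ` is the transfer operator of some Roman graded sequence. The Roman graded
sequences are the associated graded sequences of delta operators. -/
def IsTransferDiscrete (τ : LogSeries ℤ →ₗ[ℂ] LogSeries ℤ) : Prop :=
  ∃ f p, IsAssociatedDiscrete f p ∧ IsTransferOf p τ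

/-- Continuous case: `τ` is the transfer operator of some Roman graded sequence. The Roman graded
sequences are the `n`-th associated graded sequences of delta operators. -/
def IsTransferContinuous (τ : LogSeries ℝ →ₗ[ℂ] LogSeries ℝ) : Prop :=
  ∃ f n p, IsAssociatedContinuous f n p ∧ IsTransferOf p τ

end

set_option linter.unusedSectionVars false

noncomputable section

/-! ## Finite sums -/

/-! The pairing of an operator g with a series q is diagonal: ⟨g q⟩_α = ∑ g_a q_a ⌊a⌉!. Testing on
harmonic logarithms recovers each g_a, since Roman factorials never vanish; this gives uniqueness
(`isAdjoint_unique`, `isAdjointZero_unique`).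

For existence, let F_b be the powers f(D)^b (or f(D)^{b;n}) of the delta operator. The associated
relation and the normalization give ⟨F_b p_a⟩_α = ⌊a⌉! if a = b and 0 otherwise, just as D^b pairs
with λ_a (`IsDualSequence.of_act`). Let S be the substitution ∑ g_b D^b ↦ ∑ g_b F_b. Then ⟨S(g)
p_a⟩_α = ⟨g λ_a⟩_α, and continuity of τ extends this to ⟨S(g) τq⟩_α = ⟨g q⟩_α. Hence τ* = S⁻¹.

It remains that S is an automorphism of Λ⁺ (`IsPowerFamily.substEquiv`). It is multiplicative
because F_{a+b} = F_a F_b, injective because it preserves the lowest degree, and surjective by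
triangular recursion along a well-ordered set. Preservation of the lowest degree also makes S
restrict to Λ. Operators in Λ see only coefficients at nonnegative indices, where p_a^{(0)} agrees
with p_a^α, so the case α = (0) follows. -/

theorem finsum_comm_of_finite_support {α β : Type} (k : α → β → ℂ)
    (h : {x : α × β | k x.1 x.2 ≠ 0}.Finite) :
    ∑ᶠ a, ∑ᶠ b, k a b = ∑ᶠ b, ∑ᶠ a, k a b := by
  have h1 := finsum_curry (fun x : α × β => k x.1 x.2) h
  have h' : {x : β × α | k x.2 x.1 ≠ 0}.Finite :=
    (h.image Prod.swap).subset fun x hx => ⟨x.swap, hx, Prod.swap_swap x⟩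
  have h2 := finsum_curry (fun x : β × α => k x.2 x.1) h'
  exact h1.symm.trans ((finsum_comp_equiv (Equiv.prodComm β α)).symm.trans h2)

theorem mul_finsum_complex {α : Type} (c : ℂ) (f : α → ℂ) : c * ∑ᶠ a, f a = ∑ᶠ a, c * f a := by
  rcases eq_or_ne c 0 with rfl | hc
  · simp
  · exact (smul_finsum (R := ℂ) c f)

theorem finite_prod_of_fiber {α β : Type} {S : Set (α × β)} {T : Set α} (hT : T.Finite)
    (hST : ∀ x ∈ S, x.1 ∈ T) (hf : ∀ a ∈ T, {b | (a, b) ∈ S}.Finite) : S.Finite := by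
  refine (hT.biUnion fun a ha => (hf a ha).image (Prod.mk a)).subset ?_
  rintro ⟨a, b⟩ hx
  exact Set.mem_biUnion (hST _ hx) ⟨b, hx, rfl⟩

/-! ### Coefficients of products of Artinian operators. -/

section Product

variable {E : Type} [CommRing E] [LinearOrder E] [IsStrictOrderedRing E]

theorem coeff_mul_finsum (f g : ArtinianOp E) (d : E) :
    (f * g).coeff d = ∑ᶠ b, f.coeff b * g.coeff (d - b) := by
  have hinj : Set.InjOn Prod.fst
      (Finset.antidiagonal f.isPWO_support g.isPWO_support d : Set (E × E)) := by
    rintro ⟨a, b⟩ h1 ⟨a', b'⟩ h2 (rfl : a = a')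
    simp only [Finset.mem_coe, Finset.mem_antidiagonal] at h1 h2
    exact Prod.ext rfl (add_left_cancel (h1.2.2.trans h2.2.2.symm))
  rw [HahnSeries.coeff_mul, finsum_eq_sum_of_support_subset (s :=
    (Finset.antidiagonal f.isPWO_support g.isPWO_support d).image Prod.fst), Finset.sum_image hinj]
  · refine Finset.sum_congr rfl ?_
    rintro ⟨a, b⟩ h
    rw [← (Finset.mem_antidiagonal.1 h).2.2, add_sub_cancel_left]
  · intro b hb
    rw [Finset.coe_image]
    refine ⟨(b, d - b), ?_, rfl⟩
    simp only [Finset.mem_coe, Finset.mem_antidiagonal, HahnSeries.mem_support]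
    exact ⟨fun h0 => hb (by simp [h0]), fun h0 => hb (by simp [h0]), add_sub_cancel b d⟩

open scoped Pointwise in
/-- A finitely supported sum against the coefficients of a product. -/
theorem finsum_coeff_mul (f g : ArtinianOp E) (φ : E → ℂ)
    (hφ : {d | d ∈ f.support + g.support ∧ φ d ≠ 0}.Finite) :
    ∑ᶠ d, (f * g).coeff d * φ d = ∑ᶠ b, ∑ᶠ c, f.coeff b * g.coeff c * φ (b + c) := by
  have h : ∀ d, (f * g).coeff d * φ d = ∑ᶠ b, f.coeff b * g.coeff (d - b) * φ d := by
    intro d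
    rw [coeff_mul_finsum, mul_comm, mul_finsum_complex]
    exact finsum_congr fun b => mul_comm _ _
  rw [finsum_congr h, finsum_comm_of_finite_support]
  · refine finsum_congr fun b => ?_
    rw [← finsum_comp_equiv (Equiv.addLeft b)]
    simp only [Equiv.coe_addLeft, add_sub_cancel_left]
  · refine finite_prod_of_fiber hφ ?_ ?_
    · rintro ⟨d, b⟩ hx
      refine ⟨⟨b, fun h0 => hx (by simp [h0]), d - b, fun h0 => hx (by simp [h0]), ?_⟩,
        fun h0 => hx (by simp [h0])⟩
      exact add_sub_cancel b d
    · intro d _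
      refine ((Finset.antidiagonal f.isPWO_support g.isPWO_support d).finite_toSet.image
        Prod.fst).subset fun b hb => ⟨(b, d - b), ?_, rfl⟩
      simp only [Finset.mem_coe, Finset.mem_antidiagonal, HahnSeries.mem_support]
      exact ⟨fun h0 => hb (by simp [h0]), fun h0 => hb (by simp [h0]), add_sub_cancel b d⟩

end Product

/-! ## Roman factorials -/

/-- `romanFactorial` picks its k by choice; characteristic zero pins it down. -/
theorem isNegInt_choose_eq {E : Type} [Ring E] [CharZero E] {k : ℕ}
    (h : IsNegInt (-((k : E) + 1))) : h.choose = k := by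
  have h1 := h.choose_spec
  exact_mod_cast (add_right_cancel (neg_injective h1)).symm

theorem not_isNegInt_of_nonneg {E : Type} [Ring E] [LinearOrder E] [IsStrictOrderedRing E] {a : E}
    (ha : 0 ≤ a) : ¬ IsNegInt a := by
  rintro ⟨k, rfl⟩
  have h : (0 : E) < (k : E) + 1 := by positivity
  exact (neg_neg_of_pos h).not_ge ha

theorem romanFactorial_neg (k : ℕ) :
    romanFactorial (-((k : ℝ) + 1)) = (-1) ^ k / (k.factorial : ℝ) := by
  have h : IsNegInt (-((k : ℝ) + 1)) := ⟨k, rfl⟩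
  rw [romanFactorial, dif_pos h, isNegInt_choose_eq]

theorem romanFactorial_natCast (k : ℕ) : romanFactorial (k : ℝ) = k.factorial := by
  rw [romanFactorial, dif_neg (not_isNegInt_of_nonneg k.cast_nonneg), Real.Gamma_nat_eq_factorial]

theorem romanFactorial_zero : romanFactorial 0 = 1 := by
  simpa using romanFactorial_natCast 0

theorem romanFactorial_ne_zero (a : ℝ) : romanFactorial a ≠ 0 := by
  rw [romanFactorial]
  split_ifs with h
  · positivity
  · refine Real.Gamma_ne_zero fun m hm => h ⟨m, ?_⟩
    linarith

/-- At a = 0 both factorials are 1, which is why ⌊0⌉ = 1; elsewhere this is the recursion of the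
ordinary factorial or of (-1)^k / k!. -/
theorem romanFactorial_intCast (a : ℤ) :
    romanFactorial (a : ℝ) = romanNumber a * romanFactorial ((a : ℝ) - 1) := by
  obtain ⟨k, rfl | rfl⟩ := a.eq_nat_or_neg
  · rcases k with _ | k
    · have := romanFactorial_neg 0
      norm_num at this
      simp [romanNumber, romanFactorial_zero, this]
    · have h : ((((k + 1 : ℕ) : ℤ) : ℝ)) - 1 = (k : ℝ) := by push_cast; ring
      rw [h, romanFactorial_natCast, Int.cast_natCast, romanFactorial_natCast, romanNumber,
        if_neg (by positivity), Nat.factorial_succ]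
      push_cast
      ring
  · rcases k with _ | k
    · have := romanFactorial_neg 0
      norm_num at this
      simp [romanNumber, romanFactorial_zero, this]
    · have h : ((-((k + 1 : ℕ) : ℤ) : ℤ) : ℝ) - 1 = -(((k + 1 : ℕ) : ℝ) + 1) := by push_cast; ring
      have h' : ((-((k + 1 : ℕ) : ℤ) : ℤ) : ℝ) = -((k : ℝ) + 1) := by push_cast; ring
      have h0 : -((k : ℝ) + 1) ≠ 0 := by
        have : (0 : ℝ) < (k : ℝ) + 1 := by positivity
        linarith
      rw [h, romanFactorial_neg, h', romanFactorial_neg, romanNumber, if_neg h0,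
        Nat.factorial_succ]
      push_cast
      have : (k.factorial : ℝ) ≠ 0 := by positivity
      have : (k : ℝ) + 1 ≠ 0 := by positivity
      field_simp
      ring

section General

variable {E : Type} [CommRing E] [LinearOrder E] [IsStrictOrderedRing E] [Algebra E ℝ]

theorem romanRatio_ne_zero (a e : E) : romanRatio a e ≠ 0 := by
  rw [romanRatio]
  exact_mod_cast div_ne_zero (romanFactorial_ne_zero _) (romanFactorial_ne_zero _)

theorem romanRatio_self (a : E) : romanRatio a a = 1 := by
  rw [romanRatio, div_self (romanFactorial_ne_zero _), Complex.ofReal_one]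

theorem romanRatio_mul (a b c : E) : romanRatio a b * romanRatio b c = romanRatio a c := by
  simp only [romanRatio]
  rw [← Complex.ofReal_mul, div_mul_div_cancel₀ (romanFactorial_ne_zero _)]

theorem romanRatio_int_sub_one (a : ℤ) : romanRatio a (a - 1) = ((romanNumber a : ℝ) : ℂ) := by
  have h := romanFactorial_intCast a
  rw [romanRatio]
  congr 1
  rw [div_eq_iff (romanFactorial_ne_zero _)]
  simpa using h

/-! ## The action of operators -/

/-- The truncation in `act` for α = (0) spares index 0, so every α is covered. -/
theorem augmentation_act (α : LogIndex) (f : ArtinianOp E) (q : LogComp E α) :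
    augmentation (act α f q) = actCoeff f q 0 :=
  if_neg fun h => not_isNegInt_of_nonneg (le_refl (0 : E)) h.2

theorem act_coeff_of_ne_zero {α : LogIndex} (hα : α ≠ 0) (f : ArtinianOp E) (q : LogComp E α)
    (e : E) : (act α f q : NoetherianSeries E).coeff (OrderDual.toDual e) = actCoeff f q e :=
  if_neg fun h => hα h.1

theorem actCoeff_single (f : ArtinianOp E) (a : E) (c : ℂ) :
    actCoeff f (HahnSeries.single (OrderDual.toDual a) c) 0 = f.coeff a * c * romanRatio a 0 := by
  rw [actCoeff, finsum_eq_single _ a]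
  · rw [zero_add, HahnSeries.coeff_single_same]
  · intro b hb
    rw [zero_add, HahnSeries.coeff_single_of_ne (by simpa using hb), mul_zero, zero_mul]

theorem actCoeff_smul_right (f : ArtinianOp E) (c : ℂ) (q : NoetherianSeries E) (e : E) :
    actCoeff f (c • q) e = c * actCoeff f q e := by
  rw [actCoeff, actCoeff, mul_finsum_complex]
  refine finsum_congr fun b => ?_
  rw [HahnSeries.coeff_smul, smul_eq_mul]
  ring

theorem actCoeff_zero_eq (f : ArtinianOp E) (q : NoetherianSeries E) :
    actCoeff f q 0 = ∑ᶠ a, q.coeff (OrderDual.toDual a) * (f.coeff a * romanRatio a 0) := by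
  rw [actCoeff]
  refine finsum_congr fun b => ?_
  rw [zero_add]
  ring

/-- The series with a given partially well ordered support and coefficients `1`. -/
def indicatorSeries {Γ : Type} [PartialOrder Γ] (A : Set Γ) (hA : A.IsPWO) : HahnSeries Γ ℂ where
  coeff := A.indicator 1
  isPWO_support' := hA.mono Set.support_indicator_subset

theorem indicatorSeries_coeff {Γ : Type} [PartialOrder Γ] {A : Set Γ} (hA : A.IsPWO) {a : Γ}
    (ha : a ∈ A) : (indicatorSeries A hA).coeff a = 1 :=
  Set.indicator_of_mem ha 1

/-- Apply `actCoeff_finite` to series with all coefficients 1 on A and on B: no term with both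
indices in the supports cancels, because Roman ratios are nonzero. -/
theorem finite_of_isPWO_of_isPWO_dual {A : Set E} (hA : A.IsPWO) {B : Set Eᵒᵈ} (hB : B.IsPWO)
    (e : E) : {b : E | b ∈ A ∧ OrderDual.toDual (e + b) ∈ B}.Finite := by
  refine (actCoeff_finite (indicatorSeries A hA) (indicatorSeries B hB) e).subset ?_
  rintro b ⟨h1, h2⟩
  simp only [Set.mem_ofPred_eq]
  rw [indicatorSeries_coeff hA h1, indicatorSeries_coeff hB h2, one_mul, one_mul]
  exact romanRatio_ne_zero _ _

/-- The action is continuous in the series. -/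
theorem actCoeff_hsum_right {ι : Type} (f : ArtinianOp E)
    (s : HahnSeries.SummableFamily Eᵒᵈ ℂ ι) (e : E) :
    actCoeff f s.hsum e = ∑ᶠ i, actCoeff f (s i) e := by
  simp only [actCoeff]
  rw [← finsum_comm_of_finite_support]
  · refine finsum_congr fun b => ?_
    rw [HahnSeries.SummableFamily.coeff_hsum, mul_comm (f.coeff b), mul_assoc, mul_comm,
      mul_finsum_complex]
    refine finsum_congr fun i => ?_
    ring
  · refine finite_prod_of_fiber
      (finite_of_isPWO_of_isPWO_dual f.isPWO_support s.isPWO_iUnion_support e) ?_ ?_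
    · rintro ⟨b, i⟩ hx
      exact ⟨fun h0 => hx (by rw [h0, zero_mul, zero_mul]),
        Set.mem_iUnion.2 ⟨i, fun h0 => hx (by rw [h0, mul_zero, zero_mul])⟩⟩
    · intro b _
      exact (s.finite_co_support (OrderDual.toDual (e + b))).subset
        fun i hi h0 => hi (by
          have h1 : (s i).coeff (OrderDual.toDual (e + b)) = 0 := h0
          rw [h1, mul_zero, zero_mul])

/-- The action is continuous in the operator. -/
theorem actCoeff_hsum_left {ι : Type} (s : HahnSeries.SummableFamily E ℂ ι)
    (q : NoetherianSeries E) (e : E) :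
    actCoeff s.hsum q e = ∑ᶠ i, actCoeff (s i) q e := by
  simp only [actCoeff]
  rw [← finsum_comm_of_finite_support]
  · refine finsum_congr fun b => ?_
    rw [HahnSeries.SummableFamily.coeff_hsum, mul_assoc, mul_comm, mul_finsum_complex]
    refine finsum_congr fun i => ?_
    ring
  · refine finite_prod_of_fiber
      (finite_of_isPWO_of_isPWO_dual s.isPWO_iUnion_support q.isPWO_support e) ?_ ?_
    · rintro ⟨b, i⟩ hx
      exact ⟨Set.mem_iUnion.2 ⟨i, fun h0 => hx (by rw [h0, zero_mul, zero_mul])⟩,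
        fun h0 => hx (by rw [h0, mul_zero, zero_mul])⟩
    · intro b _
      exact (s.finite_co_support b).subset fun i hi h0 => hi (by simp [h0])

/-- The Roman ratios telescope along e + b + c, e + b, e. No coefficient is truncated in the
intermediate series because α ≠ (0). -/
theorem act_mul {α : LogIndex} (hα : α ≠ 0) (f g : ArtinianOp E) (q : LogComp E α) :
    act α (f * g) q = act α f (act α g q) := by
  ext x
  obtain ⟨e, rfl⟩ := OrderDual.toDual.surjective x
  rw [act_coeff_of_ne_zero hα, act_coeff_of_ne_zero hα]
  have h := finsum_coeff_mul f g
    (fun d => (q : NoetherianSeries E).coeff (OrderDual.toDual (e + d)) * romanRatio (e + d) e)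
    ((finite_of_isPWO_of_isPWO_dual (f.isPWO_support.add g.isPWO_support)
      (q : NoetherianSeries E).isPWO_support e).subset
        fun d hd => ⟨hd.1, fun h0 => hd.2 (mul_eq_zero_of_left h0 _)⟩)
  rw [actCoeff, finsum_congr fun b => mul_assoc _ _ _, h, actCoeff]
  refine finsum_congr fun b => ?_
  rw [act_coeff_of_ne_zero hα, actCoeff, mul_right_comm, mul_finsum_complex]
  refine finsum_congr fun c => ?_
  rw [← romanRatio_mul (e + (b + c)) (e + b) e, add_assoc]
  ring

theorem act_one {α : LogIndex} (hα : α ≠ 0) (q : LogComp E α) : act α 1 q = q := by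
  ext x
  obtain ⟨e, rfl⟩ := OrderDual.toDual.surjective x
  rw [act_coeff_of_ne_zero hα, actCoeff, finsum_eq_single _ 0]
  · rw [add_zero, romanRatio_self, HahnSeries.coeff_one, if_pos rfl, one_mul, mul_one]
  · intro b hb
    rw [HahnSeries.coeff_one, if_neg hb, zero_mul, zero_mul]

theorem act_smul {α : LogIndex} (hα : α ≠ 0) (f : ArtinianOp E) (c : ℂ) (q : LogComp E α) :
    act α f (c • q) = c • act α f q := by
  ext x
  obtain ⟨e, rfl⟩ := OrderDual.toDual.surjective x
  rw [act_coeff_of_ne_zero hα, Submodule.coe_smul, Submodule.coe_smul, HahnSeries.coeff_smul,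
    act_coeff_of_ne_zero hα, actCoeff_smul_right, smul_eq_mul]

end General

/-! ## Substitution of a one-parameter group of operators -/

section Substitution

variable {E : Type} [CommRing E] [LinearOrder E] [IsStrictOrderedRing E]

/-- A one-parameter group `F b` of operators with lowest term of degree `b`, all of whose exponents
lie in `b + M`, where `M` is a well ordered monoid of nonnegative exponents. -/
structure IsPowerFamily (F : E → HahnSeries E ℂ) (M : AddSubmonoid E) : Prop where
  isPWO : (M : Set E).IsPWO
  nonneg : ∀ m ∈ M, 0 ≤ m
  sub_mem : ∀ b e, (F b).coeff e ≠ 0 → e - b ∈ M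
  coeff_self : ∀ b, (F b).coeff b ≠ 0
  zero : F 0 = 1
  add : ∀ a b, F (a + b) = F a * F b

namespace IsPowerFamily

variable {F : E → HahnSeries E ℂ} {M : AddSubmonoid E}

theorem le_of_coeff_ne_zero (h : IsPowerFamily F M) {b e : E} (hbe : (F b).coeff e ≠ 0) : b ≤ e :=
  sub_nonneg.1 (h.nonneg _ (h.sub_mem b e hbe))

/-- Each such b yields a decomposition e = b + m with m in M, and two partially well-ordered sets
allow only finitely many. A single M for all b is essential here. -/
theorem finite_coeff (h : IsPowerFamily F M) {A : Set E} (hA : A.IsPWO) (e : E) :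
    {b | b ∈ A ∧ (F b).coeff e ≠ 0}.Finite := by
  refine ((Finset.antidiagonal hA h.isPWO e).finite_toSet.image Prod.fst).subset fun b hb =>
    ⟨(b, e - b), ?_, rfl⟩
  simp only [Finset.mem_coe, Finset.mem_antidiagonal]
  exact ⟨hb.1, h.sub_mem b e hb.2, add_sub_cancel b e⟩

/-- The summable family `g_b F_b`. -/
def family (h : IsPowerFamily F M) (g : HahnSeries E ℂ) : HahnSeries.SummableFamily E ℂ E where
  toFun b := g.coeff b • F b
  isPWO_iUnion_support' := by
    refine (g.isPWO_support.add h.isPWO).mono fun e he => ?_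
    obtain ⟨b, hb⟩ := Set.mem_iUnion.1 he
    rw [HahnSeries.mem_support, HahnSeries.coeff_smul] at hb
    exact ⟨b, left_ne_zero_of_mul hb, e - b, h.sub_mem b e (right_ne_zero_of_mul hb),
      add_sub_cancel b e⟩
  finite_co_support' e := by
    refine (h.finite_coeff g.isPWO_support e).subset fun b hb => ?_
    rw [Set.mem_ofPred_eq, HahnSeries.coeff_smul] at hb
    exact ⟨left_ne_zero_of_mul hb, right_ne_zero_of_mul hb⟩

/-- The substitution `∑ g_b D^b ↦ ∑ g_b F_b`. -/
def subst (h : IsPowerFamily F M) (g : HahnSeries E ℂ) : HahnSeries E ℂ := (h.family g).hsum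

theorem coeff_subst (h : IsPowerFamily F M) (g : HahnSeries E ℂ) (e : E) :
    (h.subst g).coeff e = ∑ᶠ b, g.coeff b * (F b).coeff e :=
  HahnSeries.SummableFamily.coeff_hsum

theorem finite_support_coeff (h : IsPowerFamily F M) (g : HahnSeries E ℂ) (e : E) :
    (fun b => g.coeff b * (F b).coeff e).HasFiniteSupport :=
  (h.family g).finite_co_support e

theorem subst_add (h : IsPowerFamily F M) (g g' : HahnSeries E ℂ) :
    h.subst (g + g') = h.subst g + h.subst g' := by
  ext e
  rw [HahnSeries.coeff_add, coeff_subst, coeff_subst, coeff_subst,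
    ← finsum_add_distrib (h.finite_support_coeff g e) (h.finite_support_coeff g' e)]
  exact finsum_congr fun b => by rw [HahnSeries.coeff_add, add_mul]

theorem subst_smul (h : IsPowerFamily F M) (c : ℂ) (g : HahnSeries E ℂ) :
    h.subst (c • g) = c • h.subst g := by
  ext e
  rw [HahnSeries.coeff_smul, coeff_subst, coeff_subst, smul_eq_mul, mul_finsum_complex]
  exact finsum_congr fun b => by rw [HahnSeries.coeff_smul, smul_eq_mul, mul_assoc]

theorem subst_one (h : IsPowerFamily F M) : h.subst 1 = 1 := by
  ext e
  rw [coeff_subst, finsum_eq_single _ 0, HahnSeries.coeff_one, if_pos rfl, one_mul, h.zero]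
  intro b hb
  rw [HahnSeries.coeff_one, if_neg hb, zero_mul]

theorem subst_mul (h : IsPowerFamily F M) (g g' : HahnSeries E ℂ) :
    h.subst (g * g') = h.subst g * h.subst g' := by
  ext e
  rw [coeff_subst, finsum_coeff_mul _ _ _
    (h.finite_coeff (g.isPWO_support.add g'.isPWO_support) e), subst, subst,
    ← HahnSeries.SummableFamily.hsum_mul, HahnSeries.SummableFamily.coeff_hsum,
    finsum_curry _ (HahnSeries.SummableFamily.finite_co_support _ e)]
  refine finsum_congr fun b => finsum_congr fun c => ?_
  have h1 : ((h.family g).mul (h.family g')) (b, c) = (g.coeff b • F b) * (g'.coeff c • F c) := rfl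
  -- Scalars become series of degree 0, so that they can be gathered and F b * F c merged into F (b
  -- + c).
  rw [h1, ← HahnSeries.single_zero_mul_eq_smul, ← HahnSeries.single_zero_mul_eq_smul,
    mul_mul_mul_comm, HahnSeries.single_mul_single, add_zero, ← h.add,
    HahnSeries.coeff_single_zero_mul]

/-- Terms with b > e start above e, and those with b < e vanish by assumption. -/
theorem coeff_subst_of_forall_lt (h : IsPowerFamily F M) (g : HahnSeries E ℂ) (e : E)
    (hg : ∀ b < e, g.coeff b = 0) : (h.subst g).coeff e = g.coeff e * (F e).coeff e := by
  rw [coeff_subst, finsum_eq_single _ e]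
  intro b hb
  by_contra h0
  exact left_ne_zero_of_mul h0
    (hg b (lt_of_le_of_ne (h.le_of_coeff_ne_zero (right_ne_zero_of_mul h0)) hb))

/-- Substitution preserves the lowest degree. -/
theorem forall_lt_coeff_subst_iff (h : IsPowerFamily F M) (g : HahnSeries E ℂ) (e : E) :
    (∀ b < e, (h.subst g).coeff b = 0) ↔ ∀ b < e, g.coeff b = 0 := by
  constructor
  · intro h0 b hb
    by_contra hg
    -- At the least exponent of g below e only the diagonal term contributes, so it cannot cancel.
    have hne : ({b | b < e ∧ g.coeff b ≠ 0} : Set E).Nonempty := ⟨b, hb, hg⟩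
    have hwf : ({b | b < e ∧ g.coeff b ≠ 0} : Set E).IsWF :=
      g.isWF_support.mono fun b hb => hb.2
    obtain ⟨h1, h2⟩ := hwf.min_mem hne
    refine mul_ne_zero h2 (h.coeff_self (hwf.min hne)) ?_
    rw [← h.coeff_subst_of_forall_lt, h0 _ h1]
    intro c hc
    by_contra hgc
    exact hwf.not_lt_min hne ⟨hc.trans h1, hgc⟩ hc
  · intro h0 b hb
    rw [h.coeff_subst_of_forall_lt g b fun c hc => h0 c (hc.trans hb), h0 b hb, zero_mul]

theorem subst_injective (h : IsPowerFamily F M) {g : HahnSeries E ℂ} (hg : h.subst g = 0) :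
    g = 0 := by
  ext e
  exact (h.forall_lt_coeff_subst_iff g (e + 1)).1 (fun b _ => by rw [hg, HahnSeries.coeff_zero])
    e (lt_add_one e)

/-- Well-founded recursion on P, dividing by the diagonal entry. No finiteness is needed: the same
`finsum` defines G and appears in the equation. -/
theorem exists_triangular_solution {P : Set E} (hP : P.IsWF) (A : E → E → ℂ)
    (hA : ∀ e, A e e ≠ 0) (y : E → ℂ) :
    ∃ G : E → ℂ, (∀ e ∉ P, G e = 0) ∧
      ∀ e ∈ P, G e * A e e + ∑ᶠ b, (if b < e ∧ b ∈ P then G b * A b e else 0) = y e := by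
  have hwf : WellFounded fun b e : E => b < e ∧ b ∈ P ∧ e ∈ P := Set.wellFoundedOn_iff.1 hP
  let G : E → ℂ := hwf.fix fun e rec => if e ∈ P then
    (y e - ∑ᶠ b, (if h : b < e ∧ b ∈ P ∧ e ∈ P then rec b h * A b e else 0)) / A e e else 0
  have hG : ∀ e, G e = if e ∈ P then
      (y e - ∑ᶠ b, (if b < e ∧ b ∈ P ∧ e ∈ P then G b * A b e else 0)) / A e e else 0 := by
    intro e
    have := hwf.fix_eq (fun e rec => if e ∈ P then
      (y e - ∑ᶠ b, (if h : b < e ∧ b ∈ P ∧ e ∈ P then rec b h * A b e else 0)) / A e e else 0) e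
    simpa only [dite_eq_ite] using this
  refine ⟨G, fun e he => by rw [hG, if_neg he], fun e he => ?_⟩
  rw [hG e, if_pos he, div_mul_cancel₀ _ (hA e)]
  simp only [he, and_true, sub_add_cancel]

/-- Solve the triangular system on P = supp y + M. Since P contains supp y and is stable under
adding M, both sides vanish outside P. -/
theorem subst_surjective (h : IsPowerFamily F M) (y : HahnSeries E ℂ) : ∃ g, h.subst g = y := by
  have hP := y.isPWO_support.add h.isPWO
  obtain ⟨P, hPdef⟩ : ∃ P : Set E, P = {e | ∃ a ∈ y.support, ∃ m ∈ M, a + m = e} := ⟨_, rfl⟩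
  have hPP : P.IsPWO := hP.mono (by rw [hPdef]; exact fun e he => he)
  obtain ⟨G, hG0, hG⟩ := exists_triangular_solution hPP.isWF (fun b e => (F b).coeff e)
    h.coeff_self y.coeff
  let g : HahnSeries E ℂ := ⟨G, hPP.mono fun e he => by
    by_contra he'
    exact he (hG0 e he')⟩
  refine ⟨g, HahnSeries.ext (funext fun e => ?_)⟩
  rw [coeff_subst]
  have hgG : ∀ b, g.coeff b = G b := fun _ => rfl
  by_cases he : e ∈ P
  · rw [← hG e he]
    -- Diagonal term plus terms with b < e in P; terms with b > e are zero.
    have hsplit : ∀ b, g.coeff b * (F b).coeff e = (if b = e then G e * (F e).coeff e else 0) +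
        (if b < e ∧ b ∈ P then G b * (F b).coeff e else 0) := by
      intro b
      rw [hgG]
      rcases lt_trichotomy b e with hb | rfl | hb
      · by_cases hbP : b ∈ P
        · simp [hb, hb.ne, hbP]
        · simp [hb.ne, hbP, hG0 b hbP]
      · simp
      · have h0 : (F b).coeff e = 0 := by
          by_contra h0
          exact (h.le_of_coeff_ne_zero h0).not_gt hb
        simp [hb.ne', hb.le.not_gt, h0]
    rw [finsum_congr hsplit, finsum_add_distrib, finsum_eq_single _ e, if_pos rfl]
    · intro b hb
      rw [if_neg hb]
    · exact (Set.finite_singleton e).subset fun b hb => by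
        by_contra hbe
        exact hb (if_neg hbe)
    · refine (h.finite_support_coeff g e).subset fun b hb => ?_
      intro h0
      refine hb ?_
      have h1 : G b * (F b).coeff e = 0 := h0
      simp [h1]
  · have hy : y.coeff e = 0 := by
      by_contra hy
      exact he (hPdef ▸ ⟨e, hy, 0, M.zero_mem, add_zero e⟩)
    rw [hy]
    refine finsum_eq_zero_of_forall_eq_zero fun b => ?_
    by_contra hb
    have hbP : b ∈ P := by
      by_contra hbP
      exact left_ne_zero_of_mul hb (hG0 b hbP)
    rw [hPdef] at hbP he
    obtain ⟨a, ha, m, hm, rfl⟩ := hbP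
    -- With b = a + m, the difference e - b lies in M, which would put e in P.
    exact he ⟨a, ha, m + (e - (a + m)), M.add_mem hm (h.sub_mem _ _ (right_ne_zero_of_mul hb)),
      by abel⟩

/-- Substitution is an automorphism of the algebra of Artinian operators. -/
def substEquiv (h : IsPowerFamily F M) : HahnSeries E ℂ ≃ₐ[ℂ] HahnSeries E ℂ :=
  AlgEquiv.ofBijective
    (AlgHom.ofLinearMap
      { toFun := h.subst
        map_add' := h.subst_add
        map_smul' := h.subst_smul } h.subst_one h.subst_mul)
    ⟨(injective_iff_map_eq_zero _).2 fun _ => h.subst_injective, h.subst_surjective⟩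

theorem substEquiv_apply (h : IsPowerFamily F M) (g : HahnSeries E ℂ) :
    h.substEquiv g = h.subst g := rfl

end IsPowerFamily

end Substitution

/-! ## Adjoints of transfer operators -/

section Adjoint

variable {E : Type} [CommRing E] [LinearOrder E] [IsStrictOrderedRing E] [Algebra E ℝ]

theorem coe_harmonicLog {α : LogIndex} {a : E} (h : ¬ (α = 0 ∧ IsNegInt a)) :
    (harmonicLog α a : NoetherianSeries E) = HahnSeries.single (OrderDual.toDual a) 1 := by
  rw [harmonicLog, dif_neg h]

theorem actCoeff_harmonicLog {α : LogIndex} {a : E} (h : ¬ (α = 0 ∧ IsNegInt a))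
    (f : ArtinianOp E) :
    actCoeff f (harmonicLog α a : NoetherianSeries E) 0 = f.coeff a * romanRatio a 0 := by
  rw [coe_harmonicLog h, actCoeff_single, mul_one]

/-- The expansion of a series into its terms. -/
def termFamily (q : NoetherianSeries E) : HahnSeries.SummableFamily Eᵒᵈ ℂ E where
  toFun a := HahnSeries.single (OrderDual.toDual a) (q.coeff (OrderDual.toDual a))
  isPWO_iUnion_support' := by
    refine q.isPWO_support.mono fun x hx => ?_
    obtain ⟨a, ha⟩ := Set.mem_iUnion.1 hx
    by_cases hxa : x = OrderDual.toDual a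
    · rw [hxa, HahnSeries.mem_support, HahnSeries.coeff_single_same] at ha
      exact hxa ▸ ha
    · exact absurd (HahnSeries.coeff_single_of_ne hxa) ha
  finite_co_support' x := by
    refine (Set.finite_singleton (OrderDual.ofDual x)).subset fun a ha => ?_
    by_contra hxa
    exact ha (HahnSeries.coeff_single_of_ne fun h => hxa (h ▸ rfl))

theorem termFamily_hsum (q : NoetherianSeries E) : (termFamily q).hsum = q := by
  ext x
  rw [HahnSeries.SummableFamily.coeff_hsum, finsum_eq_single _ (OrderDual.ofDual x)]
  · exact HahnSeries.coeff_single_same _ _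
  · exact fun a ha => HahnSeries.coeff_single_of_ne fun h => ha (h ▸ rfl)

theorem termFamily_apply {α : LogIndex} (q : LogComp E α) (a : E) :
    termFamily (q : NoetherianSeries E) a =
      ((logCoeff q a • harmonicLog α a : LogComp E α) : NoetherianSeries E) := by
  have h0 : termFamily (q : NoetherianSeries E) a =
    HahnSeries.single (OrderDual.toDual a) (logCoeff q a) := rfl
  by_cases h : α = 0 ∧ IsNegInt a
  · rw [h0, harmonicLog, dif_pos h, smul_zero, Submodule.coe_zero, logCoeff, q.2 h.1 a h.2,
      HahnSeries.single_eq_zero]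
  · rw [h0, Submodule.coe_smul, coe_harmonicLog h]
    ext x
    simp [HahnSeries.coeff_single]

/-- A transfer operator maps `∑ q_a λ_a` to `∑ q_a p_a`. -/
theorem IsTransferOf.actCoeff_eq {p : ∀ α : LogIndex, E → LogComp E α}
    {τ : LogSeries E →ₗ[ℂ] LogSeries E} (hτ : IsTransferOf p τ) {α : LogIndex} (f : ArtinianOp E)
    (q : LogComp E α) (e : E) :
    actCoeff f (τ (ofComp α q) α : NoetherianSeries E) e =
      ∑ᶠ a, logCoeff q a * actCoeff f (p α a : NoetherianSeries E) e := by
  have hs : ∀ a, termFamily (q : NoetherianSeries E) a ∈ LogComp E α := fun a => by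
    rw [termFamily_apply]
    exact Submodule.coe_mem _
  have hsum : (termFamily (q : NoetherianSeries E)).hsum ∈ LogComp E α := by
    rw [termFamily_hsum]
    exact q.2
  -- Continuity is applied to the expansion of q into its terms.
  obtain ⟨t, ht, htsum⟩ := hτ.1 α α E (termFamily (q : NoetherianSeries E)) hs hsum
  have hq : (⟨(termFamily (q : NoetherianSeries E)).hsum, hsum⟩ : LogComp E α) = q :=
    Subtype.ext (termFamily_hsum _)
  rw [hq] at htsum
  rw [htsum, actCoeff_hsum_right]
  refine finsum_congr fun a => ?_
  have hqa : (⟨termFamily (q : NoetherianSeries E) a, hs a⟩ : LogComp E α) =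
      logCoeff q a • harmonicLog α a := Subtype.ext (termFamily_apply q a)
  have hp : (ofComp α (p α a) : LogSeries E) α = p α a :=
    DirectSum.lof_apply (M := fun β => LogComp E β) ℂ α (p α a)
  rw [ht a, hqa, map_smul, map_smul, hτ.2, DirectSum.smul_apply, hp, Submodule.coe_smul,
    actCoeff_smul_right]

/-- Reduces an adjoint identity to harmonic logarithms. For α = (0) the negative integers may be
skipped, as q has no coefficients there. -/
theorem IsTransferOf.pairing_eq {p : ∀ α : LogIndex, E → LogComp E α}
    {τ : LogSeries E →ₗ[ℂ] LogSeries E} (hτ : IsTransferOf p τ) {α : LogIndex}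
    {f g : ArtinianOp E} (h : ∀ a, ¬ (α = 0 ∧ IsNegInt a) →
      actCoeff f (p α a : NoetherianSeries E) 0 = g.coeff a * romanRatio a 0)
    (q : LogComp E α) :
    actCoeff f (τ (ofComp α q) α : NoetherianSeries E) 0 = actCoeff g q 0 := by
  rw [hτ.actCoeff_eq, actCoeff_zero_eq]
  refine finsum_congr fun a => ?_
  by_cases ha : α = 0 ∧ IsNegInt a
  · rw [logCoeff, q.2 ha.1 a ha.2, zero_mul, zero_mul]
  · rw [h a ha, logCoeff]

/-- The powers `F b` are dual to the sequence `p`. -/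
def IsDualSequence (F : E → ArtinianOp E) (p : ∀ α : LogIndex, E → LogComp E α) : Prop :=
  ∀ α, α ≠ 0 → ∀ a b : E,
    actCoeff (F b) (p α a : NoetherianSeries E) 0 = if a = b then romanRatio a 0 else 0

/-- Take augmentations: normalization leaves only a - b = 0. -/
theorem IsDualSequence.of_act {F : E → ArtinianOp E} {p : ∀ α : LogIndex, E → LogComp E α}
    (hp : IsNormalized p)
    (h : ∀ α, α ≠ 0 → ∀ a b : E, act α (F b) (p α a) = romanRatio a (a - b) • p α (a - b)) :
    IsDualSequence F p := by
  intro α hα a b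
  have h1 : augmentation (romanRatio a (a - b) • p α (a - b)) =
      romanRatio a (a - b) * augmentation (p α (a - b)) := by
    rw [augmentation, logCoeff, Submodule.coe_smul, HahnSeries.coeff_smul, smul_eq_mul]
    rfl
  rw [← augmentation_act, h α hα, h1, hp α hα]
  simp only [sub_eq_zero]
  split_ifs with hab
  · rw [hab, sub_self, mul_one]
  · rw [mul_zero]

/-- By continuity in the operator the pairing is taken term by term in ∑ g_b F_b, and duality
selects b = a. -/
theorem IsDualSequence.pairing {F : E → ArtinianOp E} {M : AddSubmonoid E}
    {p : ∀ α : LogIndex, E → LogComp E α} (h : IsDualSequence F p) (hF : IsPowerFamily F M)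
    {α : LogIndex} (hα : α ≠ 0) (g : ArtinianOp E) (a : E) :
    actCoeff (hF.substEquiv g) (p α a : NoetherianSeries E) 0 = g.coeff a * romanRatio a 0 := by
  have h1 : ∀ b, actCoeff (hF.family g b) (p α a : NoetherianSeries E) 0 =
      g.coeff b * actCoeff (F b) (p α a : NoetherianSeries E) 0 := by
    intro b
    have h2 : hF.family g b = g.coeff b • F b := rfl
    rw [h2, actCoeff, actCoeff, mul_finsum_complex]
    refine finsum_congr fun c => ?_
    rw [HahnSeries.coeff_smul, smul_eq_mul]
    ring
  rw [hF.substEquiv_apply, IsPowerFamily.subst, actCoeff_hsum_left, finsum_congr h1,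
    finsum_eq_single _ a]
  · rw [h α hα, if_pos rfl]
  · intro b hb
    rw [h α hα, if_neg hb.symm, mul_zero]

theorem exists_logIndex_ne_zero : ∃ α : LogIndex, α ≠ 0 :=
  ⟨Finsupp.single 0 1, Finsupp.single_ne_zero.2 one_ne_zero⟩

theorem isAdjoint_unique {τ : LogSeries E →ₗ[ℂ] LogSeries E} {A B : ArtinianOp E →ₗ[ℂ] ArtinianOp E}
    (hA : IsAdjoint τ A) (hB : IsAdjoint τ B) : A = B := by
  obtain ⟨α, hα⟩ := exists_logIndex_ne_zero
  ext f a
  have h := (hA α hα f (harmonicLog α a)).trans (hB α hα f (harmonicLog α a)).symm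
  have ha : ¬ (α = 0 ∧ IsNegInt a) := fun h => hα h.1
  rw [augmentation_act, augmentation_act, actCoeff_harmonicLog ha, actCoeff_harmonicLog ha] at h
  exact mul_right_cancel₀ (romanRatio_ne_zero a 0) h

theorem IsDualSequence.isAdjoint {F : E → ArtinianOp E} {M : AddSubmonoid E}
    {p : ∀ α : LogIndex, E → LogComp E α} (h : IsDualSequence F p) (hF : IsPowerFamily F M)
    {τ : LogSeries E →ₗ[ℂ] LogSeries E} (hτ : IsTransferOf p τ) :
    IsAdjoint τ hF.substEquiv.symm.toLinearMap := by
  intro α hα f q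
  rw [augmentation_act, augmentation_act]
  refine (hτ.pairing_eq (fun a _ => ?_) q).symm
  have h1 := h.pairing hF hα (hF.substEquiv.symm f) a
  rwa [AlgEquiv.apply_symm_apply] at h1

end Adjoint

/-! ## Differential operators -/

theorem mem_diffOp_iff {f : ArtinianOp ℤ} : f ∈ DiffOp ↔ ∀ b < 0, f.coeff b = 0 := by
  constructor
  · rintro ⟨φ, rfl⟩ b hb
    refine HahnSeries.embDomain_of_notMem_range ?_
    rintro ⟨n, rfl⟩
    exact absurd hb (not_lt.2 (Int.natCast_nonneg n))
  · intro h
    refine ⟨PowerSeries.mk fun n => f.coeff n, ?_⟩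
    ext b
    rcases lt_or_ge b 0 with hb | hb
    · rw [h b hb]
      refine HahnSeries.embDomain_of_notMem_range ?_
      rintro ⟨n, rfl⟩
      exact absurd hb (not_lt.2 (Int.natCast_nonneg n))
    · lift b to ℕ using hb
      exact (HahnSeries.ofPowerSeries_apply_coeff (Γ := ℤ) _ b).trans (PowerSeries.coeff_mk _ _)

/-- The restriction of an automorphism of `Λ⁺` that preserves `Λ`. -/
def diffOpEquiv (Φ : ArtinianOp ℤ ≃ₐ[ℂ] ArtinianOp ℤ) (h : ∀ f, Φ f ∈ DiffOp ↔ f ∈ DiffOp) :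
    DiffOp ≃ₐ[ℂ] DiffOp :=
  AlgEquiv.ofAlgHom
    ((Φ.toAlgHom.comp DiffOp.val).codRestrict DiffOp fun f => (h f).2 f.2)
    ((Φ.symm.toAlgHom.comp DiffOp.val).codRestrict DiffOp fun f =>
      (h _).1 (by
        have : Φ (Φ.symm f) = f := Φ.apply_symm_apply f
        exact this.symm ▸ f.2))
    (AlgHom.ext fun f => Subtype.ext (Φ.apply_symm_apply f))
    (AlgHom.ext fun f => Subtype.ext (Φ.symm_apply_apply f))

/-- Membership in Λ means lowest degree at least 0, which substitution preserves. -/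
theorem IsPowerFamily.substEquiv_mem_diffOp {F : ℤ → ArtinianOp ℤ} {M : AddSubmonoid ℤ}
    (hF : IsPowerFamily F M) (f : ArtinianOp ℤ) : hF.substEquiv f ∈ DiffOp ↔ f ∈ DiffOp := by
  rw [mem_diffOp_iff, mem_diffOp_iff]
  exact hF.forall_lt_coeff_subst_iff f 0

theorem IsPowerFamily.substEquiv_symm_mem_diffOp {F : ℤ → ArtinianOp ℤ} {M : AddSubmonoid ℤ}
    (hF : IsPowerFamily F M) (f : ArtinianOp ℤ) : hF.substEquiv.symm f ∈ DiffOp ↔ f ∈ DiffOp := by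
  rw [← hF.substEquiv_mem_diffOp, AlgEquiv.apply_symm_apply]

theorem isAdjointZero_unique {τ : LogSeries ℤ →ₗ[ℂ] LogSeries ℤ} {A B : DiffOp →ₗ[ℂ] DiffOp}
    (hA : IsAdjointZero τ A) (hB : IsAdjointZero τ B) : A = B := by
  refine LinearMap.ext fun f => Subtype.ext (HahnSeries.ext (funext fun a => ?_))
  rcases lt_or_ge a 0 with ha | ha
  · rw [mem_diffOp_iff.1 (A f).2 a ha, mem_diffOp_iff.1 (B f).2 a ha]
  · have h := (hA f (harmonicLog 0 a)).trans (hB f (harmonicLog 0 a)).symm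
    have ha' : ¬ ((0 : LogIndex) = 0 ∧ IsNegInt a) := fun h => not_isNegInt_of_nonneg ha h.2
    rw [augmentation_act, augmentation_act, actCoeff_harmonicLog ha', actCoeff_harmonicLog ha'] at h
    exact mul_right_cancel₀ (romanRatio_ne_zero a 0) h

/-- Differential operators pair with `p_a^{(0)}` as with `p_a^α`. -/
theorem IsRegularGraded.actCoeff_zero_eq {p : ∀ α : LogIndex, ℤ → LogComp ℤ α}
    (hp : IsRegularGraded p) {f : ArtinianOp ℤ} (hf : f ∈ DiffOp) {α : LogIndex} (hα : α ≠ 0)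
    {a : ℤ} (ha : ¬ IsNegInt a) :
    actCoeff f (p 0 a : NoetherianSeries ℤ) 0 = actCoeff f (p α a : NoetherianSeries ℤ) 0 := by
  refine finsum_congr fun b => ?_
  rcases lt_or_ge b 0 with hb | hb
  · rw [mem_diffOp_iff.1 hf b hb, zero_mul, zero_mul, zero_mul, zero_mul]
  · have h := hp.regular_zero α hα a (0 + b) ha (by rw [zero_add]; exact not_isNegInt_of_nonneg hb)
    rw [logCoeff, logCoeff] at h
    rw [h]

/-- The duality is borrowed from some α ≠ (0), since p_a^{(0)} pairs with Λ in the same way. -/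
theorem IsDualSequence.isAdjointZero {F : ℤ → ArtinianOp ℤ} {M : AddSubmonoid ℤ}
    {p : ∀ α : LogIndex, ℤ → LogComp ℤ α} (h : IsDualSequence F p) (hF : IsPowerFamily F M)
    (hp : IsRegularGraded p) {τ : LogSeries ℤ →ₗ[ℂ] LogSeries ℤ} (hτ : IsTransferOf p τ) :
    IsAdjointZero τ (diffOpEquiv hF.substEquiv.symm hF.substEquiv_symm_mem_diffOp).toLinearMap := by
  intro f q
  rw [augmentation_act, augmentation_act]
  refine (hτ.pairing_eq (fun a ha => ?_) q).symm
  obtain ⟨α, hα⟩ := exists_logIndex_ne_zero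
  have h1 := h.pairing hF hα (hF.substEquiv.symm f) a
  rw [AlgEquiv.apply_symm_apply] at h1
  rw [hp.actCoeff_zero_eq f.2 hα fun h => ha ⟨rfl, h⟩, h1]
  rfl

/-! ## Integer powers of delta operators -/

theorem IsDelta.order_eq {E : Type} [CommRing E] [LinearOrder E] [IsStrictOrderedRing E]
    {f : ArtinianOp E} (hf : IsDelta f) : f.order = 1 := by
  have hf' : f.orderTop = ((1 : E) : WithTop E) := hf
  have h0 : f ≠ 0 := by
    rintro rfl
    rw [HahnSeries.orderTop_zero] at hf'
    exact WithTop.top_ne_coe hf'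
  exact WithTop.coe_injective ((HahnSeries.order_eq_orderTop_of_ne_zero h0).trans hf')

theorem IsDelta.ne_zero {E : Type} [CommRing E] [LinearOrder E] [IsStrictOrderedRing E]
    {f : ArtinianOp E} (hf : IsDelta f) : f ≠ 0 := by
  rintro rfl
  have hf' := hf.order_eq
  rw [HahnSeries.order_zero] at hf'
  exact zero_ne_one hf'

theorem HahnSeries.order_zpow {f : HahnSeries ℤ ℂ} (hf : f ≠ 0) (b : ℤ) :
    (f ^ b).order = b * f.order := by
  obtain ⟨n, rfl | rfl⟩ := b.eq_nat_or_neg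
  · rw [zpow_natCast, HahnSeries.order_pow, nsmul_eq_mul]
  · have h := HahnSeries.order_mul (pow_ne_zero n hf) (inv_ne_zero (pow_ne_zero n hf))
    rw [mul_inv_cancel₀ (pow_ne_zero n hf), HahnSeries.order_one, HahnSeries.order_pow,
      nsmul_eq_mul] at h
    rw [zpow_neg, zpow_natCast]
    linarith

theorem IsDelta.isPowerFamily_zpow {f : ArtinianOp ℤ} (hf : IsDelta f) :
    IsPowerFamily (fun b : ℤ => f ^ b) (AddSubmonoid.nonneg ℤ) := by
  have ho : ∀ b : ℤ, (f ^ b).order = b := fun b => by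
    rw [HahnSeries.order_zpow hf.ne_zero, hf.order_eq, mul_one]
  refine ⟨?_, fun m hm => hm, fun b e h => ?_, fun b => ?_, zpow_zero f,
    fun a b => zpow_add₀ hf.ne_zero a b⟩
  · exact Set.IsWF.isPWO (BddBelow.wellFoundedOn_lt ⟨0, fun m hm => hm⟩)
  · have h1 := HahnSeries.order_le_of_coeff_ne_zero h
    rw [ho] at h1
    exact sub_nonneg.2 h1
  · have h1 := HahnSeries.coeff_order_eq_zero.not.2 (zpow_ne_zero b hf.ne_zero)
    rwa [ho] at h1

theorem act_zpow {f : ArtinianOp ℤ} {p : ∀ α : LogIndex, ℤ → LogComp ℤ α}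
    (h : IsAssociatedDiscrete f p) {α : LogIndex} (hα : α ≠ 0) (a b : ℤ) :
    act α (f ^ b) (p α a) = romanRatio a (a - b) • p α (a - b) := by
  have hnat : ∀ (n : ℕ) (a : ℤ), act α (f ^ n) (p α a) = romanRatio a (a - n) • p α (a - n) := by
    intro n
    induction n with
    | zero =>
      intro a
      rw [pow_zero, act_one hα, Nat.cast_zero, sub_zero, romanRatio_self, one_smul]
    | succ n ih =>
      intro a
      rw [pow_succ', act_mul hα, ih, act_smul hα, h.2.2.2 α hα, smul_smul,
        ← romanRatio_int_sub_one, romanRatio_mul, Nat.cast_succ, sub_sub]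
  obtain ⟨n, rfl | rfl⟩ := b.eq_nat_or_neg
  · rw [zpow_natCast, hnat]
  · have h1 := congrArg (act α (f ^ (-(n : ℤ)))) (hnat n (a + n))
    rw [← act_mul hα, zpow_neg, zpow_natCast, inv_mul_cancel₀ (pow_ne_zero n h.1.ne_zero),
      act_one hα, add_sub_cancel_right, act_smul hα] at h1
    rw [sub_neg_eq_add, h1, smul_smul, romanRatio_mul, romanRatio_self, one_smul, zpow_neg,
      zpow_natCast]

/-! ## Real powers of delta operators -/

/-- Dividing f by cD leaves order 0 and leading coefficient 1, so h has positive degree and may be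
substituted into the binomial series. -/
theorem IsDelta.orderTop_pos {f : ArtinianOp ℝ} (hf : IsDelta f) :
    0 < (HahnSeries.single (-1) f.leadingCoeff⁻¹ * f - 1).orderTop := by
  have hc : f.leadingCoeff ≠ 0 := HahnSeries.leadingCoeff_ne_zero.2 hf.ne_zero
  have hs : HahnSeries.single (-1 : ℝ) f.leadingCoeff⁻¹ ≠ 0 :=
    HahnSeries.single_ne_zero (inv_ne_zero hc)
  rw [HahnSeries.orderTop_self_sub_one_pos_iff]
  constructor
  · rw [← HahnSeries.order_eq_orderTop_of_ne_zero (mul_ne_zero hs hf.ne_zero),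
      HahnSeries.order_mul hs hf.ne_zero, HahnSeries.order_single (inv_ne_zero hc), hf.order_eq,
      neg_add_cancel, WithTop.coe_zero]
  · rw [HahnSeries.leadingCoeff_mul, HahnSeries.leadingCoeff_of_single, inv_mul_cancel₀ hc]

theorem heval_support_subset {h : HahnSeries ℝ ℂ} (hh : 0 < h.orderTop) (φ : PowerSeries ℂ) :
    (PowerSeries.heval h φ).support ⊆ AddSubmonoid.closure h.support := by
  intro e he
  rw [PowerSeries.heval_apply] at he
  obtain ⟨n, hn⟩ := Set.mem_iUnion.1 (HahnSeries.SummableFamily.support_hsum_subset he)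
  rw [HahnSeries.SummableFamily.powerSeriesFamily_of_orderTop_pos hh, HahnSeries.mem_support,
    HahnSeries.coeff_smul] at hn
  exact HahnSeries.SummableFamily.support_pow_subset_closure h n (right_ne_zero_of_mul hn)

/-- The monoid generated by supp h serves all exponents b at once; it is partially well ordered
because its generators are nonnegative. The group law combines that of exp with the additivity of
binomial series in the exponent. -/
theorem IsDelta.isPowerFamily_deltaPow {f : ArtinianOp ℝ} (hf : IsDelta f) (n : ℤ) :
    IsPowerFamily (deltaPow f n) (AddSubmonoid.closure
      (HahnSeries.single (-1) f.leadingCoeff⁻¹ * f - 1 : HahnSeries ℝ ℂ).support) := by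
  have hpos := hf.orderTop_pos
  have hnn : ∀ x ∈ (HahnSeries.single (-1) f.leadingCoeff⁻¹ * f - 1 : HahnSeries ℝ ℂ).support,
      0 ≤ x := fun x hx =>
    WithTop.coe_le_coe.1 (hpos.le.trans (HahnSeries.orderTop_le_of_coeff_ne_zero hx))
  have hcoeff : ∀ b e, (deltaPow f n b).coeff e =
      Complex.exp ((b : ℂ) * (Complex.log f.leadingCoeff + 2 * Real.pi * Complex.I * (n : ℂ))) *
        (PowerSeries.heval (HahnSeries.single (-1) f.leadingCoeff⁻¹ * f - 1)
          (PowerSeries.binomialSeries ℂ b)).coeff (e - b) := fun b e => by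
    rw [deltaPow, HahnSeries.coeff_single_mul]
  refine ⟨Set.IsPWO.addSubmonoid_closure hnn (HahnSeries.isPWO_support _), fun m hm => ?_,
    fun b e h => ?_, fun b => ?_, ?_, fun a b => ?_⟩
  · exact AddSubmonoid.closure_le (S := AddSubmonoid.nonneg ℝ).2 hnn hm
  · rw [hcoeff] at h
    exact heval_support_subset hpos _ (right_ne_zero_of_mul h)
  · rw [hcoeff, sub_self, PowerSeries.coeff_heval_zero, PowerSeries.binomialSeries_constantCoeff,
      mul_one]
    exact Complex.exp_ne_zero _
  · rw [deltaPow, PowerSeries.binomialSeries_zero, map_one, Complex.ofReal_zero, zero_mul,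
      Complex.exp_zero, mul_one]
    rfl
  · rw [deltaPow, deltaPow, deltaPow, PowerSeries.binomialSeries_add, map_mul,
      mul_mul_mul_comm, HahnSeries.single_mul_single, ← Complex.exp_add, Complex.ofReal_add, add_mul]

end

theorem mainTheorem4 :
    (∀ τ : LogSeries ℝ →ₗ[ℂ] LogSeries ℝ, IsTransferContinuous τ →
      ∃ Φ : ArtinianOp ℝ ≃ₐ[ℂ] ArtinianOp ℝ,
        IsAdjoint τ Φ.toLinearMap ∧ ∀ A, IsAdjoint τ A → A = Φ.toLinearMap) ∧
    (∀ τ : LogSeries ℤ →ₗ[ℂ] LogSeries ℤ, IsTransferDiscrete τ →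
      (∃ Φ : ArtinianOp ℤ ≃ₐ[ℂ] ArtinianOp ℤ,
        IsAdjoint τ Φ.toLinearMap ∧ ∀ A, IsAdjoint τ A → A = Φ.toLinearMap) ∧
      (∃ Ψ : DiffOp ≃ₐ[ℂ] DiffOp,
        IsAdjointZero τ Ψ.toLinearMap ∧ ∀ A, IsAdjointZero τ A → A = Ψ.toLinearMap)) := by
  refine ⟨?_, ?_⟩
  · rintro τ ⟨f, n, p, ⟨hf, -, hp, hact⟩, hτ⟩
    have hadj := (IsDualSequence.of_act hp hact).isAdjoint (hf.isPowerFamily_deltaPow n) hτ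
    exact ⟨_, hadj, fun A hA => isAdjoint_unique hA hadj⟩
  · rintro τ ⟨f, p, h, hτ⟩
    -- Only the relation for f itself is given here; `act_zpow` extends it to all integer powers. In
    -- the continuous case it is part of the hypothesis.
    have hdual := IsDualSequence.of_act h.2.2.1 fun α hα => act_zpow h hα
    have hadj := hdual.isAdjoint h.1.isPowerFamily_zpow hτ
    have hadj0 := hdual.isAdjointZero h.1.isPowerFamily_zpow h.2.1 hτ
    exact ⟨⟨_, hadj, fun A hA => isAdjoint_unique hA hadj⟩,
      ⟨_, hadj0, fun A hA => isAdjointZero_unique hA hadj0⟩⟩
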